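/- **Theorem.** Let $\alpha,\beta,\gamma,\lambda,\mu>0$. A machine has state $X(t)\in\{0,1,2\}$ ($0$: free, $1$: busy with an internal job, $2$: busy with an external job), and a resource allocator holds an estimate $\hat X(t)\in\{0,1,2\}$ of it, with $X(0)=\hat X(0)=0$. The pair $Y=(X,\hat X)$ is a continuous-time Markov chain on $S=(\{0,1\}\times\{0,1\})\cup(\{0,1,2\}\times\{2\})$, driven by three kinds of events. (i) Internal events, at rate $\alpha,\beta,\gamma$ when $X=0,1,2$ respectively: $X$ moves from $0$ to $1$, from $1$ to $0$, or from $2$ to $0$, and $\hat X$ does not change. (ii) Samples, at rate $\mu$: $\hat X$ is set to $X$. (iii) Arrivals of external jobs, at rate $\lambda$: if $\hat X\neq 0$ the job is rejected and $Y$ does not change; if $\hat X=0$ the job is accepted, and then $Y$ moves to $(2,2)$ if $X=0$, while if $X\ne0$ the job is lost and $\hat X$ is set to $X$. An acceptance is false if $X\neq0$ at the arrival, and a rejection is false if $X=0$ at the arrival. Let $S_A$, $S_{FA}$, $S_R$, $S_{FR}\subseteq S$ be the sets of states in which an arriving external job is accepted, falsely accepted, rejected, falsely rejected, and let $N_A(t),N_{FA}(t),N_R(t),N_{FR}(t)$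 be the numbers of acceptances, false acceptances, rejections and false rejections by time $t$. Put $$\mathrm{FAR}=\mathbb E\Big[\limsup_{T\to\infty}\frac{N_{FA}(T)}{N_A(T)}\Big],\qquad \mathrm{FRR}=\mathbb E\Big[\limsup_{T\to\infty}\frac{N_{FR}(T)}{N_R(T)}\Big].$$ The jump chain of the system is the discrete-time chain on $S$ that makes one transition at every event, including the events that leave the state unchanged: with $\eta_i$ the total rate of events in state $i$ (so $\eta_i=\lambda+\mu+\alpha$, $\lambda+\mu+\beta$, $\lambda+\mu+\gamma$ when $X=0,1,2$ in $i$), an event of rate $\rho$ in state $i$ is the next one with probability $\rho/\eta_i$. In particular $p_i=\lambda/\eta_i$ is the probability that the transition from $i$ is due to the arrival of an external job. Then the jump chain has a unique stationary distribution $\tilde\pi$, the sums $\sum_{i\in S_A}p_i\tilde\pi_i$ and $\sum_{i\in S_R}p_i\tilde\pi_i$ are positive, and $$\mathrm{FAR}=\frac{\sum_{i\in S_{FA}}p_i\tilde\pi_i}{\sum_{i\in S_A}p_i\tilde\pi_i},\qquad \mathrm{FRR}=\frac{\sum_{i\in S_{FR}}p_i\tilde\pi_i}{\sum_{i\in S_R}p_i\tilde\pi_i};$$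 moreover, almost surely, the two limsups themselves are equal to these two ratios. -/

import Mathlib

open MeasureTheory ProbabilityTheory Filter

noncomputable section

namespace MarkovMachine

/-- The rates of the system: internal job arrivals `α`, internal service `β`, service of an external
job `γ`, external job arrivals `lam`, sampling `mu`. -/
structure Rates where
  α : ℝ
  β : ℝ
  γ : ℝ
  lam : ℝ
  mu : ℝ

/-- The joint state `(X, X̂)` of the machine and of the allocator's estimate, where `0` is free, `1` is
busy with an internal job and `2` is busy with an external job. The state space is
`{0,1} × {0,1} ∪ {0,1,2} × {2}`. -/
abbrev State : Type :=
  {y : Fin 3 × Fin 3 // (y.1 ≠ 2 ∧ y.2 ≠ 2) ∨ y.2 = 2}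

/-- The actual state of the machine. -/
def State.machine (i : State) : Fin 3 := i.1.1

/-- The allocator's estimate of the state of the machine. -/
def State.estimate (i : State) : Fin 3 := i.1.2

/-- The three kinds of events: arrival of an external job, sampling of the machine, and an internal
event of the machine (arrival of an internal job if it is free, completion of its job if not). -/
inductive Event
  | external
  | sample
  | machine
  deriving DecidableEq

instance : Fintype Event where
  elems := {.external, .sample, .machine}
  complete := by rintro (_ | _ | _) <;> decide

/-- The state after an event. Samples, and rejected external jobs, may leave the state unchanged. -/
def next (i : State) : Event → State
  | .sample => ⟨(i.machine, i.machine), by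
      by_cases h : i.machine = 2
      · exact Or.inr h
      · exact Or.inl ⟨h, h⟩⟩
  | .external =>
      if i.estimate = 0 then
        if i.machine = 0 then ⟨(2, 2), Or.inr rfl⟩
        -- the job is lost, and the allocator learns the state of the machine
        else ⟨(i.machine, i.machine), by
          by_cases h : i.machine = 2
          · exact Or.inr h
          · exact Or.inl ⟨h, h⟩⟩
      else i
  | .machine => ⟨(if i.machine = 0 then 1 else 0, i.estimate), by
      have h : (if i.machine = 0 then (1 : Fin 3) else 0) ≠ 2 := by split_ifs <;> decide
      by_cases h' : i.estimate = 2
      · exact Or.inr h'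
      · exact Or.inl ⟨h, h'⟩⟩

/-- The set `S_A` of the states in which the allocator accepts an external job. -/
def acceptStates : Finset State := {i | i.estimate = 0}

/-- The set `S_FA` of the states in which the allocator falsely accepts an external job. -/
def falseAcceptStates : Finset State := {i | i.estimate = 0 ∧ i.machine ≠ 0}

/-- The set `S_R` of the states in which the allocator rejects an external job. -/
def rejectStates : Finset State := {i | i.estimate ≠ 0}

/-- The set `S_FR` of the states in which the allocator falsely rejects an external job. -/
def falseRejectStates : Finset State := {i | i.estimate ≠ 0 ∧ i.machine = 0}

namespace Rates

/-- The rate at which an event of kind `e` occurs in state `i`. -/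
def rate (r : Rates) (i : State) : Event → ℝ
  | .external => r.lam
  | .sample => r.mu
  | .machine => ![r.α, r.β, r.γ] i.machine

/-- The total rate `η_i` of events in state `i`, those that leave the state unchanged included. -/
def totalRate (r : Rates) (i : State) : ℝ := ∑ e, r.rate i e

/-! ### The jump chain -/

/-- The probability that the transition of the jump chain from state `i` is due to an event of
kind `e`. -/
def jumpProb (r : Rates) (i : State) (e : Event) : ℝ := r.rate i e / r.totalRate i

/-- The probability `p_i` that the transition of the jump chain from state `i` is due to the arrival
of an external job. -/
def externalProb (r : Rates) (i : State) : ℝ := r.jumpProb i .external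

/-- The transition matrix of the jump chain, which has a transition, possibly from a state to itself,
at every event. -/
def jumpMatrix (r : Rates) : Matrix State State ℝ :=
  Matrix.of fun i j => ∑ e, if next i e = j then r.jumpProb i e else 0

/-- `p` is a stationary distribution of the jump chain. -/
def IsStationary (r : Rates) (p : State → ℝ) : Prop :=
  p ∈ stdSimplex ℝ State ∧ Matrix.vecMul p r.jumpMatrix = p

/-! ### The continuous-time system

The system is the continuous-time Markov chain with labelled transitions that has the rates above,
realized by competing exponential clocks: after each event (and at time `0`) every kind of event `e`
gets a fresh exponential clock, whose parameter is the rate of `e` in the current state, and the clock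
that rings first determines the next event. By the lack of memory of the exponential law, external
jobs then arrive, and samples are taken, at the times of independent Poisson processes of rates `lam`
and `mu`, and the machine makes its internal transitions at the rates `α`, `β`, `γ`. The variables `x n e` are the standard exponential
variables from which the clocks are made. -/

/-- The time to go, on the clock of kind `e`, in state `i`, if the standard exponential variable of
this clock has the value `x e`. -/
def clock (r : Rates) (i : State) (x : Event → ℝ) (e : Event) : ℝ := x e / r.rate i e

/-- The kind of the event whose clock rings first. -/
def firstEvent (r : Rates) (i : State) (x : Event → ℝ) : Event :=
  if r.clock i x .external ≤ r.clock i x .sample ∧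
      r.clock i x .external ≤ r.clock i x .machine then .external
  else if r.clock i x .sample ≤ r.clock i x .machine then .sample
  else .machine

/-- The time until the first clock rings. -/
def waitingTime (r : Rates) (i : State) (x : Event → ℝ) : ℝ :=
  min (r.clock i x .external) (min (r.clock i x .sample) (r.clock i x .machine))

/-- The state after the first `n` events, starting from `X(0) = X̂(0) = 0`. -/
def stateAfter (r : Rates) (x : ℕ → Event → ℝ) : ℕ → State
  | 0 => ⟨(0, 0), Or.inl ⟨by decide, by decide⟩⟩
  | n + 1 => next (r.stateAfter x n) (r.firstEvent (r.stateAfter x n) (x n))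

/-- The kind of the event number `n` (counted from `0`). -/
def eventAt (r : Rates) (x : ℕ → Event → ℝ) (n : ℕ) : Event :=
  r.firstEvent (r.stateAfter x n) (x n)

/-- The time at which the event number `n` (counted from `0`) occurs. -/
def eventTime (r : Rates) (x : ℕ → Event → ℝ) (n : ℕ) : ℝ :=
  ∑ k ∈ Finset.range (n + 1), r.waitingTime (r.stateAfter x k) (x k)

/-- The number of external jobs that arrive by time `t` and find the system in a state in `A`. -/
def arrivalCount (r : Rates) (x : ℕ → Event → ℝ) (A : Finset State) (t : ℝ) : ℕ :=
  {n : ℕ | r.eventTime x n ≤ t ∧ r.eventAt x n = .external ∧ r.stateAfter x n ∈ A}.ncard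

/-- The ratio of the number of false acceptances to the number of acceptances by time `t`. -/
def falseAcceptRatio (r : Rates) (x : ℕ → Event → ℝ) (t : ℝ) : ℝ :=
  (r.arrivalCount x falseAcceptStates t : ℝ) / (r.arrivalCount x acceptStates t : ℝ)

/-- The ratio of the number of false rejections to the number of rejections by time `t`. -/
def falseRejectRatio (r : Rates) (x : ℕ → Event → ℝ) (t : ℝ) : ℝ :=
  (r.arrivalCount x falseRejectStates t : ℝ) / (r.arrivalCount x rejectStates t : ℝ)

/-- The false acceptance ratio. -/
def FAR (r : Rates) {Ω : Type*} [MeasurableSpace Ω] (P : Measure Ω) (ξ : ℕ → Event → Ω → ℝ) : ℝ :=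
  ∫ ω, limsup (fun t : ℝ => r.falseAcceptRatio (fun n e => ξ n e ω) t) atTop ∂P

/-- The false rejection ratio. -/
def FRR (r : Rates) {Ω : Type*} [MeasurableSpace Ω] (P : Measure Ω) (ξ : ℕ → Event → Ω → ℝ) : ℝ :=
  ∫ ω, limsup (fun t : ℝ => r.falseRejectRatio (fun n e => ξ n e ω) t) atTop ∂P

end Rates

end MarkovMachine

end

/-!
The proof is a strong law for the jump chain, read off at the event times.

*Strong law.* Whether the clocks with number `k` produce an event of kind `e` in state `i` is
independent of the past, and has the probability `r.jumpProb i e` (`measureReal_firstEvent_eq`). So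
the differences between the indicator of "the transition `k` starts from `i` and is of kind `e`" and
`r.jumpProb i e` times the indicator of "the transition `k` starts from `i`" are bounded and
orthogonal, and their averages tend to `0` almost surely (`ae_tendsto_average_of_orthogonal`). Hence
almost every path is typical in the sense of `Rates.IsTypical`.

*Convergence of the frequencies.* On a typical path the vector of visit frequencies is asymptotically
invariant, because every transition that does not end the path leads into the start of the next one.
Its cluster points, which exist by compactness of the simplex, are therefore stationary distributions;
this proves existence. Irreducibility gives uniqueness (`Rates.IsStationary.eq`), and then the
frequencies converge to the only cluster point `p`, and the frequency of the transitions from `i` that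
are due to external arrivals converges to `r.externalProb i * p i`.

*Continuous time.* The event times almost surely increase to infinity, so that the ratios of the
counts by time `t` run through the ratios of the counts among the first `n` events, and have the limit
claimed. The limsups are almost surely constant, which also gives their expectations.
-/

/-! ### Averages of bounded orthogonal variables -/

namespace MarkovMachine

open scoped Topology

section Averages

variable {Ω : Type*} [MeasurableSpace Ω] {P : Measure Ω} [IsProbabilityMeasure P]

theorem abs_sum_range_le {Ω : Type*} {D : ℕ → Ω → ℝ} (hb : ∀ k ω, |D k ω| ≤ 1) (n : ℕ) (ω : Ω) :
    |∑ k ∈ Finset.range n, D k ω| ≤ n := by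
  calc |∑ k ∈ Finset.range n, D k ω| ≤ ∑ k ∈ Finset.range n, |D k ω| :=
        Finset.abs_sum_le_sum_abs _ _
    _ ≤ ∑ k ∈ Finset.range n, (1 : ℝ) := Finset.sum_le_sum fun k _ => hb k ω
    _ = n := by simp

theorem integrable_of_abs_le {f : Ω → ℝ} {C : ℝ} (hf : Measurable f) (hb : ∀ ω, |f ω| ≤ C) :
    Integrable f P :=
  Integrable.of_bound hf.aestronglyMeasurable C (.of_forall hb)

theorem integral_sum_range_sq_le {D : ℕ → Ω → ℝ} (hm : ∀ k, Measurable (D k))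
    (hb : ∀ k ω, |D k ω| ≤ 1) (horth : ∀ j k, j < k → ∫ ω, D j ω * D k ω ∂P = 0) (n : ℕ) :
    ∫ ω, (∑ k ∈ Finset.range n, D k ω) ^ 2 ∂P ≤ n := by
  have hSm : ∀ n, Measurable fun ω => ∑ k ∈ Finset.range n, D k ω := fun n => by fun_prop
  have hmul : ∀ j k, Integrable (fun ω => D j ω * D k ω) P := fun j k =>
    integrable_of_abs_le (C := 1) (by fun_prop) fun ω => by
      rw [abs_mul]
      exact mul_le_one₀ (hb j ω) (abs_nonneg _) (hb k ω)
  have hSD : ∀ n, ∫ ω, (∑ k ∈ Finset.range n, D k ω) * D n ω ∂P = 0 := fun n => by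
    simp_rw [Finset.sum_mul]
    rw [integral_finsetSum _ fun j _ => hmul j n]
    exact Finset.sum_eq_zero fun j hj => horth j n (Finset.mem_range.1 hj)
  induction n with
  | zero => simp
  | succ n ih =>
    have h1 : Integrable (fun ω => (∑ k ∈ Finset.range n, D k ω) ^ 2) P :=
      integrable_of_abs_le (C := (n : ℝ) ^ 2) (by fun_prop) fun ω => by
        rw [abs_pow]
        exact pow_le_pow_left₀ (abs_nonneg _) (abs_sum_range_le hb n ω) 2
    have h2 : Integrable (fun ω => 2 * ((∑ k ∈ Finset.range n, D k ω) * D n ω)) P :=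
      (integrable_of_abs_le (C := (n : ℝ)) (by fun_prop) fun ω => by
        rw [abs_mul]
        exact (mul_le_of_le_one_right (abs_nonneg _) (hb n ω)).trans
          (abs_sum_range_le hb n ω)).const_mul 2
    have h3 : ∫ ω, D n ω * D n ω ∂P ≤ 1 := by
      calc ∫ ω, D n ω * D n ω ∂P ≤ ∫ _, (1 : ℝ) ∂P :=
            integral_mono (hmul n n) (integrable_const _) fun ω => by
              have := abs_le.1 (hb n ω)
              nlinarith
        _ = 1 := by simp
    have hexp : ∀ ω, (∑ k ∈ Finset.range (n + 1), D k ω) ^ 2 =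
        (∑ k ∈ Finset.range n, D k ω) ^ 2 + 2 * ((∑ k ∈ Finset.range n, D k ω) * D n ω) +
          D n ω * D n ω := fun ω => by
      rw [Finset.sum_range_succ]
      ring
    simp_rw [hexp]
    have h12 := integral_add h1 h2
    have h123 := integral_add (h1.add h2) (hmul n n)
    simp only [Pi.add_apply] at h123
    rw [h123, h12, integral_const_mul, hSD]
    push_cast
    linarith

/-- The means of the squares of the averages along `n ↦ (n + 1) ^ 2` are summable, so these averages
tend to `0`; between consecutive squares the partial sums move by a negligible amount. -/
theorem ae_tendsto_average_of_orthogonal {D : ℕ → Ω → ℝ} (hm : ∀ k, Measurable (D k))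
    (hb : ∀ k ω, |D k ω| ≤ 1) (horth : ∀ j k, j < k → ∫ ω, D j ω * D k ω ∂P = 0) :
    ∀ᵐ ω ∂P, Tendsto (fun n : ℕ => (∑ k ∈ Finset.range n, D k ω) / n) atTop (𝓝 0) := by
  set c : ℕ → ℕ := fun n => (n + 1) ^ 2 with hc
  have hcpos : ∀ n, (0 : ℝ) < c n := fun n => by simp only [hc]; positivity
  set f : ℕ → Ω → ℝ := fun n ω => ((∑ k ∈ Finset.range (c n), D k ω) / c n) ^ 2 with hf
  have hfm : ∀ n, Measurable (f n) := fun n => by simp only [hf]; fun_prop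
  have hf0 : ∀ n ω, 0 ≤ f n ω := fun n ω => sq_nonneg _
  have hfi : ∀ n, Integrable (f n) P := fun n =>
    integrable_of_abs_le (C := 1) (hfm n) fun ω => by
      rw [abs_of_nonneg (hf0 n ω)]
      simp only [hf]
      rw [sq_le_one_iff_abs_le_one, abs_div, abs_of_pos (hcpos n), div_le_one (hcpos n)]
      exact abs_sum_range_le hb _ ω
  have hfint : ∀ n, ∫ ω, f n ω ∂P ≤ 1 / ((n : ℝ) + 1) ^ 2 := fun n => by
    simp only [hf, div_pow]
    rw [integral_div]
    calc (∫ ω, (∑ k ∈ Finset.range (c n), D k ω) ^ 2 ∂P) / (c n : ℝ) ^ 2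
        ≤ (c n : ℝ) / (c n : ℝ) ^ 2 := by
          gcongr
          exact integral_sum_range_sq_le hm hb horth (c n)
      _ = 1 / (c n : ℝ) := by
          have := (hcpos n).ne'
          field_simp
      _ = 1 / ((n : ℝ) + 1) ^ 2 := by simp [hc]
  have hsum : Summable fun n : ℕ => 1 / ((n : ℝ) + 1) ^ 2 := by
    have := (summable_nat_add_iff 1).2 (Real.summable_one_div_nat_pow.2 (one_lt_two))
    simpa using this
  have htsum : ∫⁻ ω, ∑' n, ENNReal.ofReal (f n ω) ∂P ≠ ⊤ := by
    rw [lintegral_tsum fun n => (hfm n).ennreal_ofReal.aemeasurable]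
    refine ne_top_of_le_ne_top hsum.tsum_ofReal_ne_top (ENNReal.tsum_le_tsum fun n => ?_)
    rw [← ofReal_integral_eq_lintegral_ofReal (hfi n) (.of_forall (hf0 n))]
    exact ENNReal.ofReal_le_ofReal (hfint n)
  have hmeas : Measurable fun ω => ∑' n, ENNReal.ofReal (f n ω) :=
    Measurable.tsum fun n => (hfm n).ennreal_ofReal
  filter_upwards [ae_lt_top hmeas htsum] with ω hω
  have hsq : Tendsto (fun n => f n ω) atTop (𝓝 0) := by
    have h := (ENNReal.tendsto_toReal ENNReal.zero_ne_top).comp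
      (ENNReal.tendsto_atTop_zero_of_tsum_ne_top hω.ne)
    simpa [Function.comp_def, ENNReal.toReal_ofReal (hf0 _ ω)] using h
  have hsub : Tendsto (fun n => (∑ k ∈ Finset.range (c n), D k ω) / c n) atTop (𝓝 0) := by
    refine (tendsto_zero_iff_abs_tendsto_zero _).2 ?_
    simpa [hf, Real.sqrt_sq_eq_abs, Function.comp_def] using hsq.sqrt
  -- Adding `n` to the partial sums makes them monotone.
  have hmono : Tendsto (fun n : ℕ => ((∑ k ∈ Finset.range n, D k ω) + n) / n) atTop (𝓝 1) := by
    refine tendsto_div_of_monotone_of_exists_subseq_tendsto_div _ 1 ?_ fun a ha => ⟨c, ?_, ?_, ?_⟩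
    · refine monotone_nat_of_le_succ fun n => ?_
      have := abs_le.1 (hb n ω)
      rw [Finset.sum_range_succ]
      push_cast
      linarith
    · have h1 : Tendsto (fun n : ℕ => (1 + 1 / ((n : ℝ) + 1)) ^ 2) atTop (𝓝 1) := by
        simpa using (tendsto_one_div_add_atTop_nhds_zero_nat (𝕜 := ℝ)).const_add 1 |>.pow 2
      filter_upwards [h1.eventually_lt_const ha] with n hn
      have h2 : ((c (n + 1) : ℕ) : ℝ) = (1 + 1 / ((n : ℝ) + 1)) ^ 2 * c n := by
        simp only [hc]
        push_cast
        field_simp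
      rw [h2]
      exact mul_le_mul_of_nonneg_right hn.le (hcpos n).le
    · exact tendsto_atTop_mono (fun n => by simp only [hc, id]; nlinarith) tendsto_id
    · refine (by simpa using hsub.add_const 1 : Tendsto _ _ (𝓝 (1 : ℝ))).congr fun n => ?_
      rw [add_div, div_self (hcpos n).ne']
  refine (by simpa using hmono.sub_const 1 : Tendsto _ _ (𝓝 (0 : ℝ))).congr' ?_
  filter_upwards [eventually_gt_atTop 0] with n hn
  have : (n : ℝ) ≠ 0 := by positivity
  field_simp
  ring

end Averages

/-! ### Competing exponential clocks -/

section Race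

theorem expMeasure_one_Ici (t : ℝ) (ht : 0 ≤ t) :
    expMeasure 1 (Set.Ici t) = ENNReal.ofReal (Real.exp (-t)) := by
  have := isProbabilityMeasure_expMeasure one_pos
  have hac : expMeasure 1 ≪ volume := withDensity_absolutelyContinuous _ _
  have h0 : expMeasure 1 {t} = 0 := hac (by simp)
  have h1 : (expMeasure 1).real (Set.Iic t) = 1 - Real.exp (-t) := by
    rw [← cdf_eq_real, cdf_expMeasure_eq one_pos, if_pos ht, one_mul]
  have h2 : (expMeasure 1).real (Set.Ioi t) = Real.exp (-t) := by
    rw [← Set.compl_Iic, probReal_compl_eq_one_sub measurableSet_Iic, h1]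
    ring
  rw [← measure_congr (Ioi_ae_eq_Ici' h0), ← h2, ofReal_measureReal]

theorem lintegral_exp_neg_mul_expMeasure {s : ℝ} (hs : 0 ≤ s) :
    ∫⁻ x, ENNReal.ofReal (Real.exp (-(s * x))) ∂(expMeasure 1) = ENNReal.ofReal (1 / (1 + s)) := by
  have hpdf : ∀ x, exponentialPDF 1 x * ENNReal.ofReal (Real.exp (-(s * x))) =
      ENNReal.ofReal (1 / (1 + s)) * exponentialPDF (1 + s) x := fun x => by
    simp only [exponentialPDF_eq]
    rw [← ENNReal.ofReal_mul (by positivity), ← ENNReal.ofReal_mul' (by positivity)]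
    congr 1
    split_ifs
    · rw [one_mul, ← Real.exp_add]
      field_simp
      ring_nf
    · simp
  have hm : Measurable (exponentialPDF 1) := (measurable_exponentialPDFReal 1).ennreal_ofReal
  change ∫⁻ x, _ ∂(volume.withDensity (exponentialPDF 1)) = _
  rw [lintegral_withDensity_eq_lintegral_mul _ hm (by fun_prop)]
  simp only [Pi.mul_apply, hpdf]
  have hm' : Measurable (exponentialPDF (1 + s)) := (measurable_exponentialPDFReal _).ennreal_ofReal
  rw [lintegral_const_mul _ hm', lintegral_exponentialPDF_eq_one (by positivity), mul_one]

theorem ae_nonneg_expMeasure_one : ∀ᵐ x ∂(expMeasure 1), 0 ≤ x := by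
  have := isProbabilityMeasure_expMeasure one_pos
  have h := expMeasure_one_Ici 0 le_rfl
  simp only [neg_zero, Real.exp_zero, ENNReal.ofReal_one] at h
  exact (prob_compl_eq_zero_iff measurableSet_Ici).2 h

variable {Ω : Type*} [MeasurableSpace Ω] {P : Measure Ω} [IsProbabilityMeasure P]

/-- Among three independent exponential clocks of rates `a`, `b`, `c`, the first one rings before the
two others with probability `a / (a + b + c)`. -/
theorem measure_clock_le_clocks {X Y Z : Ω → ℝ} {a b c : ℝ} (ha : 0 < a) (hb : 0 < b) (hc : 0 < c)
    (hXm : Measurable X) (hYm : Measurable Y) (hZm : Measurable Z)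
    (hX : HasLaw X (expMeasure 1) P) (hY : HasLaw Y (expMeasure 1) P)
    (hZ : HasLaw Z (expMeasure 1) P) (hYZ : IndepFun Y Z P)
    (hXYZ : IndepFun X (fun ω => (Y ω, Z ω)) P) :
    P {ω | X ω / a ≤ Y ω / b ∧ X ω / a ≤ Z ω / c} = ENNReal.ofReal (a / (a + b + c)) := by
  have := isProbabilityMeasure_expMeasure one_pos
  have hlaw : P.map (fun ω => (X ω, Y ω, Z ω)) =
      (expMeasure 1).prod ((expMeasure 1).prod (expMeasure 1)) := by
    rw [(indepFun_iff_map_prod_eq_prod_map_map hXm.aemeasurable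
      (hYm.prodMk hZm).aemeasurable).1 hXYZ,
      (indepFun_iff_map_prod_eq_prod_map_map hYm.aemeasurable hZm.aemeasurable).1 hYZ,
      hX.map_eq, hY.map_eq, hZ.map_eq]
  set A : Set (ℝ × ℝ × ℝ) := {x | x.1 / a ≤ x.2.1 / b ∧ x.1 / a ≤ x.2.2 / c} with hA
  have hAm : MeasurableSet A :=
    (measurableSet_le (f := fun x : ℝ × ℝ × ℝ => x.1 / a) (g := fun x => x.2.1 / b)
      (by fun_prop) (by fun_prop)).inter
    (measurableSet_le (f := fun x : ℝ × ℝ × ℝ => x.1 / a) (g := fun x => x.2.2 / c)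
      (by fun_prop) (by fun_prop))
  have hpre : {ω | X ω / a ≤ Y ω / b ∧ X ω / a ≤ Z ω / c} =
      (fun ω => (X ω, Y ω, Z ω)) ⁻¹' A := rfl
  rw [hpre, ← Measure.map_apply (by fun_prop) hAm, hlaw, Measure.prod_apply hAm]
  have hsec : ∀ x : ℝ, Prod.mk x ⁻¹' A = Set.Ici (b * (x / a)) ×ˢ Set.Ici (c * (x / a)) := fun x => by
    ext ⟨y, z⟩
    simp only [hA, Set.mem_preimage, Set.mem_ofPred_eq, Set.mem_prod, Set.mem_Ici, le_div_iff₀ hb,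
      le_div_iff₀ hc, mul_comm]
  simp only [hsec, Measure.prod_prod]
  have hs : (0 : ℝ) ≤ (b + c) / a := by positivity
  calc _ = ∫⁻ x, ENNReal.ofReal (Real.exp (-((b + c) / a * x))) ∂(expMeasure 1) := by
        refine lintegral_congr_ae ?_
        filter_upwards [ae_nonneg_expMeasure_one] with x hx
        rw [expMeasure_one_Ici _ (by positivity), expMeasure_one_Ici _ (by positivity),
          ← ENNReal.ofReal_mul (by positivity), ← Real.exp_add]
        ring_nf
    _ = _ := by
        rw [lintegral_exp_neg_mul_expMeasure hs]
        congr 1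
        field_simp
        ring

end Race

/-! ### Stationary distributions of the jump chain -/

section Stationary

/-- The jump chain is irreducible: every state is reached from every other one by some events. -/
theorem exists_foldl_next_eq (i j : State) : ∃ w : List Event, w.foldl next i = j := by
  -- Sampling a free machine leads to `(0, 0)`, and a machine is free after at most one event.
  have h₁ : ∀ i : State, ∃ w ∈ [[Event.sample], [Event.machine, Event.sample]],
      w.foldl next i = ⟨(0, 0), Or.inl ⟨by decide, by decide⟩⟩ := by decide
  have h₂ : ∀ j : State, ∃ w ∈ [[], [Event.machine], [Event.machine, Event.sample],
      [Event.machine, Event.sample, Event.machine], [Event.external],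
      [Event.external, Event.machine], [Event.external, Event.machine, Event.machine]],
      w.foldl next ⟨(0, 0), Or.inl ⟨by decide, by decide⟩⟩ = j := by decide
  obtain ⟨w₁, -, hw₁⟩ := h₁ i
  obtain ⟨w₂, -, hw₂⟩ := h₂ j
  exact ⟨w₁ ++ w₂, by rw [List.foldl_append, hw₁, hw₂]⟩

variable {r : Rates}

theorem Rates.rate_pos (hα : 0 < r.α) (hβ : 0 < r.β) (hγ : 0 < r.γ) (hlam : 0 < r.lam)
    (hmu : 0 < r.mu) (i : State) (e : Event) : 0 < r.rate i e := by
  cases e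
  · exact hlam
  · exact hmu
  · simp only [Rates.rate]
    generalize i.machine = y
    fin_cases y <;> assumption

theorem sum_event {M : Type*} [AddCommMonoid M] (f : Event → M) :
    ∑ e, f e = f .external + (f .sample + f .machine) := by
  change ∑ e ∈ {Event.external, Event.sample, Event.machine}, f e = _
  rw [Finset.sum_insert (by decide), Finset.sum_insert (by decide), Finset.sum_singleton]

theorem Rates.totalRate_pos (hr : ∀ i e, 0 < r.rate i e) (i : State) : 0 < r.totalRate i :=
  Finset.sum_pos (fun e _ => hr i e) ⟨.external, Finset.mem_univ _⟩

theorem Rates.jumpProb_pos (hr : ∀ i e, 0 < r.rate i e) (i : State) (e : Event) :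
    0 < r.jumpProb i e :=
  div_pos (hr i e) (Rates.totalRate_pos hr i)

theorem Rates.sum_jumpProb (hr : ∀ i e, 0 < r.rate i e) (i : State) :
    ∑ e, r.jumpProb i e = 1 := by
  simp only [Rates.jumpProb, ← Finset.sum_div]
  exact div_self (Rates.totalRate_pos hr i).ne'

theorem Rates.vecMul_jumpMatrix (v : State → ℝ) (j : State) :
    Matrix.vecMul v r.jumpMatrix j =
      ∑ i, ∑ e, if next i e = j then v i * r.jumpProb i e else 0 := by
  simp [Matrix.vecMul, dotProduct, Rates.jumpMatrix, Finset.mul_sum]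

theorem Rates.mul_jumpProb_le (hr : ∀ i e, 0 < r.rate i e) {v : State → ℝ} (hv : 0 ≤ v)
    (hst : Matrix.vecMul v r.jumpMatrix = v) (i : State) (e : Event) :
    v i * r.jumpProb i e ≤ v (next i e) := by
  have hterm : ∀ i' e', 0 ≤ if next i' e' = next i e then v i' * r.jumpProb i' e' else 0 :=
    fun i' e' => by
      split_ifs
      · exact mul_nonneg (hv i') (Rates.jumpProb_pos hr i' e').le
      · exact le_rfl
  rw [← congrFun hst (next i e), Rates.vecMul_jumpMatrix]
  calc v i * r.jumpProb i e
      = if next i e = next i e then v i * r.jumpProb i e else 0 := by rw [if_pos rfl]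
    _ ≤ ∑ e', if next i e' = next i e then v i * r.jumpProb i e' else 0 :=
        Finset.single_le_sum (f := fun e' => if next i e' = next i e then v i * r.jumpProb i e' else 0)
          (fun e' _ => hterm i e') (Finset.mem_univ e)
    _ ≤ _ := Finset.single_le_sum
          (f := fun i' => ∑ e', if next i' e' = next i e then v i' * r.jumpProb i' e' else 0)
          (fun i' _ => Finset.sum_nonneg fun e' _ => hterm i' e') (Finset.mem_univ i)

/-- By irreducibility, the support of a nonnegative invariant vector is empty or everything. -/
theorem Rates.pos_of_pos (hr : ∀ i e, 0 < r.rate i e) {v : State → ℝ} (hv : 0 ≤ v)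
    (hst : Matrix.vecMul v r.jumpMatrix = v) {i : State} (hi : 0 < v i) (j : State) : 0 < v j := by
  obtain ⟨w, rfl⟩ := exists_foldl_next_eq i j
  induction w generalizing i with
  | nil => exact hi
  | cons e w ih =>
    exact ih ((mul_pos hi (Rates.jumpProb_pos hr i e)).trans_le (Rates.mul_jumpProb_le hr hv hst i e))

theorem Rates.IsStationary.pos (hr : ∀ i e, 0 < r.rate i e) {p : State → ℝ} (hp : r.IsStationary p)
    (j : State) : 0 < p j := by
  obtain ⟨i, hi⟩ : ∃ i, 0 < p i := by
    by_contra! h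
    have := Finset.sum_nonpos fun i (_ : i ∈ Finset.univ) => h i
    linarith [hp.1.2]
  exact Rates.pos_of_pos hr (fun i => hp.1.1 i) hp.2 hi j

/-- If `c` is the least of the ratios `q i / p i`, then `q - c • p` is nonnegative, invariant, and
vanishes somewhere, so that it vanishes everywhere. -/
theorem Rates.IsStationary.eq (hr : ∀ i e, 0 < r.rate i e) {p q : State → ℝ}
    (hp : r.IsStationary p) (hq : r.IsStationary q) : q = p := by
  obtain ⟨i, -, hi⟩ := Finset.exists_min_image Finset.univ (fun i => q i / p i)
    ⟨⟨(2, 2), Or.inr rfl⟩, Finset.mem_univ _⟩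
  set c := q i / p i with hc
  have hv : 0 ≤ q - c • p := fun j => by
    have := (le_div_iff₀ (hp.pos hr j)).1 (hi j (Finset.mem_univ j))
    simpa using this
  have hst : Matrix.vecMul (q - c • p) r.jumpMatrix = q - c • p := by
    rw [Matrix.sub_vecMul, Matrix.smul_vecMul, hp.2, hq.2]
  have hvi : (q - c • p) i = 0 := by
    have := (hp.pos hr i).ne'
    simp only [Pi.sub_apply, Pi.smul_apply, smul_eq_mul, hc]
    field_simp
    ring
  have hzero : ∀ j, q j = c * p j := fun j => by
    by_contra hne
    have hj : 0 < (q - c • p) j := lt_of_le_of_ne (hv j) fun h => hne (by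
      simpa [sub_eq_zero] using h.symm)
    exact (Rates.pos_of_pos hr hv hst hj i).ne' hvi
  have hc1 : c = 1 := by
    have h := hq.1.2
    simp_rw [hzero, ← Finset.mul_sum, hp.1.2, mul_one] at h
    exact h
  funext j
  rw [hzero, hc1, one_mul]

end Stationary

/-! ### Frequencies along a path -/

section Frequencies

variable (r : Rates) (x : ℕ → Event → ℝ)

/-- The proportion of the first `n` transitions of the jump chain that start from `i`. -/
noncomputable def Rates.visitFreq (n : ℕ) (i : State) : ℝ :=
  (∑ k ∈ Finset.range n, if r.stateAfter x k = i then (1 : ℝ) else 0) / n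

/-- The proportion of the first `n` transitions of the jump chain that start from `i` and are due to
an event of kind `e`. -/
noncomputable def Rates.transitionFreq (n : ℕ) (i : State) (e : Event) : ℝ :=
  (∑ k ∈ Finset.range n,
    if r.stateAfter x k = i ∧ r.eventAt x k = e then (1 : ℝ) else 0) / n

/-- A path is typical if, in the long run, the events that occur in a state `i` are of kind `e` with
the frequency prescribed by the jump chain. Normalizing by the total number of events, instead of the
number of visits to `i`, makes sense of this without recurrence. -/
def Rates.IsTypical : Prop :=
  ∀ i e, Tendsto (fun n => r.transitionFreq x n i e - r.visitFreq x n i * r.jumpProb i e) atTop (𝓝 0)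

theorem Rates.visitFreq_mem_stdSimplex {n : ℕ} (hn : 0 < n) :
    r.visitFreq x n ∈ stdSimplex ℝ State := by
  refine ⟨fun i => div_nonneg (Finset.sum_nonneg fun k _ => ?_) n.cast_nonneg, ?_⟩
  · split_ifs <;> norm_num
  · simp only [Rates.visitFreq, ← Finset.sum_div]
    rw [Finset.sum_comm]
    have : (n : ℝ) ≠ 0 := by positivity
    simp [this]

/-- The flow into `j` balances the visits to `j`, up to the end points of the path. -/
theorem Rates.sum_transitionFreq_sub_visitFreq (n : ℕ) (j : State) :
    (∑ i, ∑ e, if next i e = j then r.transitionFreq x n i e else 0) - r.visitFreq x n j =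
      ((if r.stateAfter x n = j then (1 : ℝ) else 0) -
        if r.stateAfter x 0 = j then (1 : ℝ) else 0) / n := by
  have hstep : ∀ k, (∑ i, ∑ e, if next i e = j then
      (if r.stateAfter x k = i ∧ r.eventAt x k = e then (1 : ℝ) else 0) else 0) =
      if r.stateAfter x (k + 1) = j then (1 : ℝ) else 0 := fun k => by
    rw [Finset.sum_eq_single (r.stateAfter x k), Finset.sum_eq_single (r.eventAt x k)]
    · simp only [Rates.stateAfter, Rates.eventAt, and_self, if_true]
      rfl
    · intro e _ he
      simp [he.symm]
    · simp
    · intro i _ hi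
      simp [hi.symm]
    · simp
  have hsum : (∑ i, ∑ e, if next i e = j then r.transitionFreq x n i e else 0) =
      (∑ k ∈ Finset.range n, if r.stateAfter x (k + 1) = j then (1 : ℝ) else 0) / n := by
    simp_rw [← hstep]
    rw [Finset.sum_comm (s := Finset.range n), Finset.sum_div]
    refine Finset.sum_congr rfl fun i _ => ?_
    rw [Finset.sum_comm (s := Finset.range n), Finset.sum_div]
    refine Finset.sum_congr rfl fun e _ => ?_
    split_ifs
    · rfl
    · simp
  rw [hsum, Rates.visitFreq, ← sub_div]
  congr 1
  exact Finset.sum_range_sub (f := fun k => if r.stateAfter x k = j then (1 : ℝ) else 0) n ▸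
    (Finset.sum_sub_distrib _ _).symm

variable {r x}

theorem Rates.IsTypical.tendsto_vecMul_sub (hx : r.IsTypical x) :
    Tendsto (fun n => Matrix.vecMul (r.visitFreq x n) r.jumpMatrix - r.visitFreq x n) atTop
      (𝓝 0) := by
  rw [tendsto_pi_nhds]
  intro j
  have hflow : Tendsto (fun n : ℕ => ((if r.stateAfter x n = j then (1 : ℝ) else 0) -
        if r.stateAfter x 0 = j then (1 : ℝ) else 0) / n) atTop (𝓝 0) := by
    refine squeeze_zero_norm (fun n => ?_) tendsto_one_div_atTop_nhds_zero_nat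
    rw [norm_div, Real.norm_natCast]
    refine div_le_div_of_nonneg_right ?_ n.cast_nonneg
    split_ifs <;> norm_num
  have hdiff : Tendsto (fun n => ∑ i, ∑ e, if next i e = j then
      r.transitionFreq x n i e - r.visitFreq x n i * r.jumpProb i e else 0) atTop (𝓝 0) := by
    have hterm : ∀ i e, Tendsto (fun n => if next i e = j then
        r.transitionFreq x n i e - r.visitFreq x n i * r.jumpProb i e else 0) atTop (𝓝 0) :=
      fun i e => by
        split_ifs
        · exact hx i e
        · exact tendsto_const_nhds
    have hsum := tendsto_finsetSum Finset.univ fun i _ =>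
      tendsto_finsetSum Finset.univ fun e _ => hterm i e
    simpa only [Finset.sum_const_zero] using hsum
  have hlim := hflow.sub hdiff
  rw [sub_zero] at hlim
  refine hlim.congr fun n => ?_
  rw [← Rates.sum_transitionFreq_sub_visitFreq, Pi.sub_apply, Rates.vecMul_jumpMatrix,
    sub_right_comm, ← Finset.sum_sub_distrib]
  congr 1
  refine Finset.sum_congr rfl fun i _ => ?_
  rw [← Finset.sum_sub_distrib]
  refine Finset.sum_congr rfl fun e _ => ?_
  split_ifs <;> ring

theorem Rates.IsTypical.isStationary_of_mapClusterPt (hx : r.IsTypical x) {p : State → ℝ}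
    (hmem : p ∈ stdSimplex ℝ State) (hp : MapClusterPt p atTop (r.visitFreq x)) :
    r.IsStationary p := by
  have hcont : Continuous fun v : State → ℝ => Matrix.vecMul v r.jumpMatrix - v := by fun_prop
  have hclust := hp.continuousAt_comp hcont.continuousAt
  have hzero : Matrix.vecMul p r.jumpMatrix - p = 0 :=
    eq_of_nhds_neBot (hclust.clusterPt.mono hx.tendsto_vecMul_sub)
  exact ⟨hmem, sub_eq_zero.1 hzero⟩

theorem Rates.IsTypical.exists_isStationary (hx : r.IsTypical x) : ∃ p, r.IsStationary p := by
  have hev : ∀ᶠ n in atTop, r.visitFreq x n ∈ stdSimplex ℝ State :=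
    (eventually_gt_atTop 0).mono fun n hn => r.visitFreq_mem_stdSimplex x hn
  obtain ⟨p, hmem, hp⟩ := (isCompact_stdSimplex ℝ State).exists_mapClusterPt_of_frequently
    hev.frequently
  exact ⟨p, hx.isStationary_of_mapClusterPt hmem hp⟩

theorem Rates.IsTypical.tendsto_visitFreq (hx : r.IsTypical x) (hr : ∀ i e, 0 < r.rate i e)
    {p : State → ℝ} (hp : r.IsStationary p) : Tendsto (r.visitFreq x) atTop (𝓝 p) :=
  (isCompact_stdSimplex ℝ State).tendsto_nhds_of_unique_mapClusterPt
    ((eventually_gt_atTop 0).mono fun _ hn => r.visitFreq_mem_stdSimplex x hn)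
    fun _ hmem hq => hp.eq hr (hx.isStationary_of_mapClusterPt hmem hq)

theorem Rates.IsTypical.tendsto_transitionFreq (hx : r.IsTypical x) (hr : ∀ i e, 0 < r.rate i e)
    {p : State → ℝ} (hp : r.IsStationary p) (i : State) (e : Event) :
    Tendsto (fun n => r.transitionFreq x n i e) atTop (𝓝 (r.jumpProb i e * p i)) := by
  have h := (hx i e).add
    (((tendsto_pi_nhds.1 (hx.tendsto_visitFreq hr hp) i)).mul_const (r.jumpProb i e))
  simpa [mul_comm] using h

/-! ### Passage to continuous time -/

/-- If the event times are nondecreasing and tend to infinity, then the events up to time `t` are the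
first `m t` ones, for some `m t` that tends to infinity with `t`. -/
theorem Rates.exists_eventTime_le_iff (hmono : Monotone (r.eventTime x))
    (htop : Tendsto (r.eventTime x) atTop atTop) :
    ∃ m : ℝ → ℕ, Tendsto m atTop atTop ∧ ∀ t n, r.eventTime x n ≤ t ↔ n < m t := by
  have hex : ∀ t, ∃ n, t < r.eventTime x n := fun t => (htop.eventually_gt_atTop t).exists
  classical
  have hm : ∀ t n, r.eventTime x n ≤ t ↔ n < Nat.find (hex t) := fun t n => by
    rw [Nat.lt_find_iff]
    exact ⟨fun h k hk => not_lt.2 ((hmono hk).trans h), fun h => not_lt.1 (h n le_rfl)⟩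
  refine ⟨fun t => Nat.find (hex t), tendsto_atTop.2 fun n => ?_, hm⟩
  filter_upwards [eventually_ge_atTop (r.eventTime x n)] with t ht
  exact ((hm t n).1 ht).le

theorem Rates.arrivalCount_eq {t : ℝ} {m : ℕ} (hm : ∀ n, r.eventTime x n ≤ t ↔ n < m)
    (A : Finset State) :
    (r.arrivalCount x A t : ℝ) = ∑ i ∈ A, m * r.transitionFreq x m i .external := by
  rcases Nat.eq_zero_or_pos m with rfl | hpos
  · simp [Rates.arrivalCount, hm]
  have hset : {n : ℕ | r.eventTime x n ≤ t ∧ r.eventAt x n = .external ∧ r.stateAfter x n ∈ A} =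
      ((Finset.range m).filter fun n => r.eventAt x n = .external ∧ r.stateAfter x n ∈ A) := by
    ext n
    simp [hm]
  have hm0 : (m : ℝ) ≠ 0 := by positivity
  rw [Rates.arrivalCount, hset, Set.ncard_coe_finset, Finset.card_filter]
  simp only [Rates.transitionFreq, mul_div_cancel₀ _ hm0]
  rw [Finset.sum_comm]
  push_cast
  refine Finset.sum_congr rfl fun k _ => ?_
  by_cases hA : r.stateAfter x k ∈ A <;> by_cases he : r.eventAt x k = .external <;> simp [hA, he]

/-- On a typical path with event times that tend to infinity, the ratio of the numbers of arrivals in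
two sets of states tends to the ratio of the stationary frequencies of these arrivals. -/
theorem Rates.IsTypical.tendsto_arrivalCount_div (hx : r.IsTypical x)
    (hr : ∀ i e, 0 < r.rate i e) (hmono : Monotone (r.eventTime x))
    (htop : Tendsto (r.eventTime x) atTop atTop) {p : State → ℝ} (hp : r.IsStationary p)
    (A : Finset State) {B : Finset State} (hB : 0 < ∑ i ∈ B, r.externalProb i * p i) :
    Tendsto (fun t => (r.arrivalCount x A t : ℝ) / (r.arrivalCount x B t : ℝ)) atTop
      (𝓝 ((∑ i ∈ A, r.externalProb i * p i) / ∑ i ∈ B, r.externalProb i * p i)) := by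
  obtain ⟨m, hmtop, hm⟩ := Rates.exists_eventTime_le_iff hmono htop
  have hfreq : ∀ A : Finset State,
      Tendsto (fun t => ∑ i ∈ A, r.transitionFreq x (m t) i .external) atTop
        (𝓝 (∑ i ∈ A, r.externalProb i * p i)) := fun A =>
    (tendsto_finsetSum _ fun i _ => hx.tendsto_transitionFreq hr hp i .external).comp hmtop
  refine ((hfreq A).div (hfreq B) hB.ne').congr' ?_
  filter_upwards [hmtop.eventually_gt_atTop 0] with t ht
  have hm0 : (m t : ℝ) ≠ 0 := by positivity
  rw [Pi.div_apply, Rates.arrivalCount_eq (hm t), Rates.arrivalCount_eq (hm t), ← Finset.mul_sum,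
    ← Finset.mul_sum, mul_div_mul_left _ _ hm0]

theorem sum_externalProb_mul_pos (hr : ∀ i e, 0 < r.rate i e) {p : State → ℝ}
    (hp : r.IsStationary p) {A : Finset State} (hA : A.Nonempty) :
    0 < ∑ i ∈ A, r.externalProb i * p i :=
  Finset.sum_pos (fun i _ => mul_pos (Rates.jumpProb_pos hr i _) (hp.pos hr i)) hA

end Frequencies

/-! ### Typical paths have probability one -/

section Independence

variable {Ω : Type*} {ξ : ℕ → Event → Ω → ℝ}

/-- The `σ`-algebra generated by the standard exponential variables `ξ n e` with `n ∈ S`; for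
`S = Set.Iio k` this is the information available just before the transition number `k`. -/
abbrev clockInfo (ξ : ℕ → Event → Ω → ℝ) (S : Set ℕ) : MeasurableSpace Ω :=
  ⨆ ne ∈ {ne : ℕ × Event | ne.1 ∈ S}, MeasurableSpace.comap (ξ ne.1 ne.2) inferInstance

theorem measurable_clockInfo {S : Set ℕ} {n : ℕ} (hn : n ∈ S) (e : Event) :
    Measurable[clockInfo ξ S] (ξ n e) :=
  measurable_iff_comap_le.2 (le_iSup₂_of_le (n, e) hn le_rfl)

theorem measurable_pi_clockInfo {S : Set ℕ} {n : ℕ} (hn : n ∈ S) :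
    Measurable[clockInfo ξ S] fun ω e => ξ n e ω :=
  @measurable_pi_lambda _ _ _ (clockInfo ξ S) _ _ fun e => measurable_clockInfo hn e

theorem clockInfo_mono {S T : Set ℕ} (h : S ⊆ T) : clockInfo ξ S ≤ clockInfo ξ T :=
  biSup_mono fun _ hne => h hne

variable [MeasurableSpace Ω] {P : Measure Ω}

theorem clockInfo_le (hm : ∀ n e, Measurable (ξ n e)) (S : Set ℕ) :
    clockInfo ξ S ≤ (inferInstance : MeasurableSpace Ω) :=
  iSup₂_le fun ne _ => (hm ne.1 ne.2).comap_le

theorem indep_clockInfo (hm : ∀ n e, Measurable (ξ n e))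
    (hind : iIndepFun (fun ne : ℕ × Event => ξ ne.1 ne.2) P) {S T : Set ℕ} (h : Disjoint S T) :
    Indep (clockInfo ξ S) (clockInfo ξ T) P :=
  indep_iSup_of_disjoint
    (m := fun ne : ℕ × Event => MeasurableSpace.comap (ξ ne.1 ne.2) inferInstance)
    (fun ne => (hm ne.1 ne.2).comap_le) hind
    (Set.disjoint_left.2 fun _ hS hT => Set.disjoint_left.1 h hS hT)

variable [IsProbabilityMeasure P]

/-- If `A k` is an event that depends only on the clocks before the `k`-th ones, then in the long run
the `k`-th clocks fall into `B` with their probability `q` along the `k` for which `A k` occurs. -/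
theorem ae_tendsto_average_indicator (hm : ∀ n e, Measurable (ξ n e))
    (hind : iIndepFun (fun ne : ℕ × Event => ξ ne.1 ne.2) P) {A : ℕ → Set Ω}
    (hA : ∀ k, MeasurableSet[clockInfo ξ (Set.Iio k)] (A k)) {B : Set (Event → ℝ)}
    (hB : MeasurableSet B) {q : ℝ} (hq : ∀ k, P.real {ω | (fun e => ξ k e ω) ∈ B} = q) :
    ∀ᵐ ω ∂P, Tendsto (fun n : ℕ => (∑ k ∈ Finset.range n, (A k).indicator 1 ω *
      (B.indicator 1 (fun e => ξ k e ω) - q)) / n) atTop (𝓝 0) := by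
  have hle := clockInfo_le hm
  have hBk : ∀ {S : Set ℕ} {k}, k ∈ S →
      Measurable[clockInfo ξ S] fun ω => B.indicator (1 : (Event → ℝ) → ℝ) (fun e => ξ k e ω) - q :=
    fun hk => (((measurable_const (a := (1 : ℝ))).indicator hB).comp
      (measurable_pi_clockInfo hk)).sub_const q
  have hAk : ∀ k, Measurable[clockInfo ξ (Set.Iio k)] ((A k).indicator (1 : Ω → ℝ)) := fun k =>
    (@measurable_const _ _ _ (clockInfo ξ (Set.Iio k)) (1 : ℝ)).indicator (hA k)
  have hDk : ∀ {j k : ℕ}, j < k → Measurable[clockInfo ξ (Set.Iio k)] fun ω =>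
      (A j).indicator (1 : Ω → ℝ) ω *
        (B.indicator (1 : (Event → ℝ) → ℝ) (fun e => ξ j e ω) - q) := fun {j k} hjk =>
    ((hAk j).mono (clockInfo_mono (Set.Iio_subset_Iio hjk.le)) le_rfl).mul (hBk hjk)
  have hq0 : 0 ≤ q := hq 0 ▸ measureReal_nonneg
  have hq1 : q ≤ 1 := hq 0 ▸ measureReal_le_one
  refine ae_tendsto_average_of_orthogonal (fun k => (hDk k.lt_succ_self).mono (hle _) le_rfl)
    (fun k ω => ?_) fun j k hjk => ?_
  · by_cases h1 : ω ∈ A k <;> by_cases h2 : (fun e => ξ k e ω) ∈ B <;> simp [h1, h2] <;>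
      rw [abs_le] <;> constructor <;> linarith
  · have hF : Measurable[clockInfo ξ (Set.Iio k)] fun ω => (A j).indicator (1 : Ω → ℝ) ω *
        (B.indicator (1 : (Event → ℝ) → ℝ) (fun e => ξ j e ω) - q) *
          (A k).indicator (1 : Ω → ℝ) ω := (hDk hjk).mul (hAk k)
    have hG := hBk (Set.mem_singleton k)
    have hFG : IndepFun (fun ω => (A j).indicator (1 : Ω → ℝ) ω *
        (B.indicator (1 : (Event → ℝ) → ℝ) (fun e => ξ j e ω) - q) *
          (A k).indicator (1 : Ω → ℝ) ω)
        (fun ω => B.indicator (1 : (Event → ℝ) → ℝ) (fun e => ξ k e ω) - q) P :=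
      (IndepFun_iff_Indep _ _ _).2 (indep_of_indep_of_le_left (indep_of_indep_of_le_right
        (indep_clockInfo hm hind (by simp)) hG.comap_le) hF.comap_le)
    have hzero : ∫ ω, (B.indicator (1 : (Event → ℝ) → ℝ) (fun e => ξ k e ω) - q) ∂P = 0 := by
      have hmeas : MeasurableSet {ω | (fun e => ξ k e ω) ∈ B} :=
        (measurable_pi_lambda _ fun e => hm k e) hB
      have hind1 : (fun ω => B.indicator (1 : (Event → ℝ) → ℝ) (fun e => ξ k e ω)) =
          {ω | (fun e => ξ k e ω) ∈ B}.indicator 1 := rfl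
      rw [integral_sub _ (integrable_const _), hind1, integral_indicator_one hmeas, hq]
      · simp
      · rw [hind1]
        exact (integrable_const (1 : ℝ)).indicator hmeas
    calc _ = ∫ ω, ((A j).indicator (1 : Ω → ℝ) ω *
        (B.indicator (1 : (Event → ℝ) → ℝ) (fun e => ξ j e ω) - q) *
          (A k).indicator (1 : Ω → ℝ) ω) *
            (B.indicator (1 : (Event → ℝ) → ℝ) (fun e => ξ k e ω) - q) ∂P := by
          simp only [mul_assoc]
      _ = 0 := by
          rw [hFG.integral_fun_mul_eq_mul_integral (hF.mono (hle _) le_rfl).aestronglyMeasurable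
            (hG.mono (hle _) le_rfl).aestronglyMeasurable, hzero, mul_zero]

end Independence

section Typical

variable {r : Rates}

theorem Rates.measurableSet_firstEvent_eq (r : Rates) (i : State) (e : Event) :
    MeasurableSet {y : Event → ℝ | r.firstEvent i y = e} := by
  let _ : MeasurableSpace Event := ⊤
  have hle : ∀ e₁ e₂, MeasurableSet {y : Event → ℝ | r.clock i y e₁ ≤ r.clock i y e₂} :=
    fun e₁ e₂ => measurableSet_le ((measurable_pi_apply e₁).div_const _)
      ((measurable_pi_apply e₂).div_const _)
  have h : Measurable (r.firstEvent i) :=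
    Measurable.ite ((hle _ _).inter (hle _ _)) measurable_const
      (Measurable.ite (hle _ _) measurable_const measurable_const)
  exact h (measurableSet_singleton e)

theorem measurableSet_stateAfter_eq (r : Rates) {Ω : Type*} (ξ : ℕ → Event → Ω → ℝ) (k : ℕ)
    (i : State) :
    MeasurableSet[clockInfo ξ (Set.Iio k)] {ω | r.stateAfter (fun n e => ξ n e ω) k = i} := by
  induction k generalizing i with
  | zero =>
    simp only [Rates.stateAfter]
    exact @MeasurableSet.const _ (clockInfo ξ (Set.Iio 0)) _
  | succ k ih =>
    have hset : {ω | r.stateAfter (fun n e => ξ n e ω) (k + 1) = i} =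
        ⋃ j, ⋃ e, ⋃ _ : next j e = i, {ω | r.stateAfter (fun n e => ξ n e ω) k = j} ∩
          (fun ω e => ξ k e ω) ⁻¹' {y | r.firstEvent j y = e} := by
      ext ω
      simp [Rates.stateAfter]
    rw [hset]
    refine MeasurableSet.iUnion fun j => MeasurableSet.iUnion fun e => MeasurableSet.iUnion fun _ => ?_
    exact (clockInfo_mono (Set.Iio_subset_Iio k.le_succ) _ (ih j)).inter
      (measurable_pi_clockInfo (Set.mem_Iio.2 k.lt_succ_self) (r.measurableSet_firstEvent_eq j e))

variable {Ω : Type*} [MeasurableSpace Ω] {P : Measure Ω} {ξ : ℕ → Event → Ω → ℝ}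

theorem ae_nonneg_clocks (hlaw : ∀ n e, HasLaw (ξ n e) (expMeasure 1) P) :
    ∀ᵐ ω ∂P, ∀ n e, 0 ≤ ξ n e ω := by
  simp only [ae_all_iff]
  intro n e
  refine ae_of_ae_map (hlaw n e).aemeasurable ?_
  rw [(hlaw n e).map_eq]
  exact ae_nonneg_expMeasure_one

variable [IsProbabilityMeasure P]

theorem measure_clock_le (hr : ∀ i e, 0 < r.rate i e) (hm : ∀ n e, Measurable (ξ n e))
    (hlaw : ∀ n e, HasLaw (ξ n e) (expMeasure 1) P)
    (hind : iIndepFun (fun ne : ℕ × Event => ξ ne.1 ne.2) P) (k : ℕ) (i : State)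
    {e e₁ e₂ : Event} (h₁ : e₁ ≠ e) (h₂ : e₂ ≠ e) (h₁₂ : e₁ ≠ e₂) :
    P {ω | r.clock i (fun e => ξ k e ω) e ≤ r.clock i (fun e => ξ k e ω) e₁ ∧
      r.clock i (fun e => ξ k e ω) e ≤ r.clock i (fun e => ξ k e ω) e₂} =
      ENNReal.ofReal (r.rate i e / (r.rate i e + r.rate i e₁ + r.rate i e₂)) :=
  measure_clock_le_clocks (hr i e) (hr i e₁) (hr i e₂) (hm k e) (hm k e₁) (hm k e₂) (hlaw k e)
    (hlaw k e₁) (hlaw k e₂)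
    (hind.indepFun (i := (k, e₁)) (j := (k, e₂)) (by simpa using h₁₂))
    (hind.indepFun_prodMk (fun ne => hm ne.1 ne.2) (k, e₁) (k, e₂) (k, e)
      (by simpa using h₁) (by simpa using h₂)).symm

theorem measureReal_firstEvent_le (hr : ∀ i e, 0 < r.rate i e) (hm : ∀ n e, Measurable (ξ n e))
    (hlaw : ∀ n e, HasLaw (ξ n e) (expMeasure 1) P)
    (hind : iIndepFun (fun ne : ℕ × Event => ξ ne.1 ne.2) P) (k : ℕ) (i : State) (e : Event) :
    P.real {ω | r.firstEvent i (fun e => ξ k e ω) = e} ≤ r.jumpProb i e := by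
  refine ENNReal.toReal_le_of_le_ofReal (Rates.jumpProb_pos hr i e).le ?_
  have hclock := fun e e₁ e₂ => measure_clock_le (e := e) (e₁ := e₁) (e₂ := e₂) hr hm hlaw hind k i
  rw [Rates.jumpProb, Rates.totalRate, sum_event]
  cases e
  · rw [← add_assoc, ← hclock .external .sample .machine (by decide) (by decide) (by decide)]
    refine measure_mono fun ω hω => ?_
    simp only [Rates.firstEvent, Set.mem_ofPred_eq] at hω ⊢
    split_ifs at hω with h1
    exact h1
  · rw [add_left_comm, ← add_assoc, ← hclock .sample .external .machine (by decide) (by decide)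
      (by decide)]
    refine measure_mono fun ω hω => ?_
    simp only [Rates.firstEvent, Set.mem_ofPred_eq] at hω ⊢
    split_ifs at hω with h1 h2
    refine ⟨?_, h2⟩
    by_contra! h
    exact h1 ⟨h.le, h.le.trans h2⟩
  · rw [add_comm, add_right_comm, add_comm, ← add_assoc, ← hclock .machine .sample .external
      (by decide) (by decide) (by decide)]
    refine measure_mono fun ω hω => ?_
    simp only [Rates.firstEvent, Set.mem_ofPred_eq] at hω ⊢
    split_ifs at hω with h1 h2
    push Not at h2
    refine ⟨h2.le, ?_⟩
    by_contra! h
    exact h1 ⟨(h.trans h2).le, h.le⟩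

/-- The upper bounds for the probabilities of the three kinds of events add up to one, so that they are
attained; in particular ties between the clocks need no separate treatment. -/
theorem measureReal_firstEvent_eq (hr : ∀ i e, 0 < r.rate i e) (hm : ∀ n e, Measurable (ξ n e))
    (hlaw : ∀ n e, HasLaw (ξ n e) (expMeasure 1) P)
    (hind : iIndepFun (fun ne : ℕ × Event => ξ ne.1 ne.2) P) (k : ℕ) (i : State) (e : Event) :
    P.real {ω | r.firstEvent i (fun e => ξ k e ω) = e} = r.jumpProb i e := by
  have hmeas : ∀ e, MeasurableSet {ω | r.firstEvent i (fun e => ξ k e ω) = e} := fun e =>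
    (measurable_pi_lambda _ fun e => hm k e) (r.measurableSet_firstEvent_eq i e)
  have hsum : ∑ e, P.real {ω | r.firstEvent i (fun e => ξ k e ω) = e} = ∑ e, r.jumpProb i e := by
    rw [Rates.sum_jumpProb hr, ← measureReal_biUnion_finset _ fun e _ => hmeas e]
    · have : (⋃ e ∈ Finset.univ, {ω | r.firstEvent i (fun e => ξ k e ω) = e}) = Set.univ := by
        ext ω
        simp
      rw [this, probReal_univ]
    · intro e₁ _ e₂ _ hne
      exact Set.disjoint_left.2 fun ω h₁ h₂ => hne (h₁.symm.trans h₂)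
  exact (Finset.sum_eq_sum_iff_of_le fun e _ =>
    measureReal_firstEvent_le hr hm hlaw hind k i e).1 hsum e (Finset.mem_univ e)

theorem ae_isTypical (hr : ∀ i e, 0 < r.rate i e) (hm : ∀ n e, Measurable (ξ n e))
    (hlaw : ∀ n e, HasLaw (ξ n e) (expMeasure 1) P)
    (hind : iIndepFun (fun ne : ℕ × Event => ξ ne.1 ne.2) P) :
    ∀ᵐ ω ∂P, r.IsTypical fun n e => ξ n e ω := by
  simp only [Rates.IsTypical, ae_all_iff]
  intro i e
  filter_upwards [ae_tendsto_average_indicator hm hind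
    (fun k => measurableSet_stateAfter_eq r ξ k i) (r.measurableSet_firstEvent_eq i e)
    fun k => measureReal_firstEvent_eq hr hm hlaw hind k i e] with ω hω
  refine hω.congr fun n => ?_
  rw [Rates.transitionFreq, Rates.visitFreq, div_mul_eq_mul_div, ← sub_div, Finset.sum_mul,
    ← Finset.sum_sub_distrib]
  congr 1
  refine Finset.sum_congr rfl fun k _ => ?_
  by_cases h : r.stateAfter (fun n e => ξ n e ω) k = i
  · simp [h, Set.indicator, Rates.eventAt]
  · simp [h]

theorem Rates.waitingTime_nonneg (hr : ∀ i e, 0 < r.rate i e) (i : State) {y : Event → ℝ}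
    (hy : ∀ e, 0 ≤ y e) : 0 ≤ r.waitingTime i y := by
  have h : ∀ e, 0 ≤ r.clock i y e := fun e => div_nonneg (hy e) (hr i e).le
  exact le_min (h _) (le_min (h _) (h _))

theorem Rates.monotone_eventTime (hr : ∀ i e, 0 < r.rate i e) {x : ℕ → Event → ℝ}
    (hx : ∀ n e, 0 ≤ x n e) : Monotone (r.eventTime x) :=
  monotone_nat_of_le_succ fun n => by
    rw [Rates.eventTime, Rates.eventTime, Finset.sum_range_succ _ (n + 1)]
    exact le_add_of_nonneg_right (Rates.waitingTime_nonneg hr _ (hx _))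

/-- A waiting time is at least a fixed `c > 0` whenever all its standard exponential variables are at
least `1`, which occurs with positive frequency. -/
theorem ae_tendsto_eventTime (hr : ∀ i e, 0 < r.rate i e) (hm : ∀ n e, Measurable (ξ n e))
    (hlaw : ∀ n e, HasLaw (ξ n e) (expMeasure 1) P)
    (hind : iIndepFun (fun ne : ℕ × Event => ξ ne.1 ne.2) P) :
    ∀ᵐ ω ∂P, Tendsto (r.eventTime fun n e => ξ n e ω) atTop atTop := by
  set B : Set (Event → ℝ) := Set.univ.pi fun _ => Set.Ici 1 with hBdef
  have hB : MeasurableSet B := MeasurableSet.univ_pi fun _ => measurableSet_Ici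
  have hq : ∀ k, P.real {ω | (fun e => ξ k e ω) ∈ B} = ∏ _e : Event, Real.exp (-1) := fun k => by
    have hk : iIndepFun (ξ k) P := hind.precomp (g := fun e => (k, e)) fun _ _ h => by simpa using h
    have h := hk.measure_inter_preimage_eq_mul Finset.univ (sets := fun _ => Set.Ici 1)
      fun _ _ => measurableSet_Ici
    have hset : {ω | (fun e => ξ k e ω) ∈ B} = ⋂ e ∈ Finset.univ, ξ k e ⁻¹' Set.Ici 1 := by
      ext ω
      simp [hBdef, Pi.le_def]
    rw [measureReal_def, hset, h, ENNReal.toReal_prod]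
    refine Finset.prod_congr rfl fun e _ => ?_
    rw [← Measure.map_apply (hm k e) measurableSet_Ici, (hlaw k e).map_eq,
      expMeasure_one_Ici 1 zero_le_one, ENNReal.toReal_ofReal (Real.exp_pos _).le]
  set q := ∏ _e : Event, Real.exp (-1)
  have hqpos : 0 < q := Finset.prod_pos fun _ _ => Real.exp_pos _
  have : Nonempty (State × Event) := ⟨⟨(2, 2), Or.inr rfl⟩, .external⟩
  obtain ⟨⟨i₀, e₀⟩, hmin⟩ := Finite.exists_min fun ie : State × Event => 1 / r.rate ie.1 ie.2
  set c := 1 / r.rate i₀ e₀ with hc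
  have hcpos : 0 < c := one_div_pos.2 (hr i₀ e₀)
  filter_upwards [ae_nonneg_clocks hlaw, ae_tendsto_average_indicator hm hind
    (A := fun _ => Set.univ) (fun _ => MeasurableSet.univ) hB hq] with ω hω hlim
  have hwait : ∀ k, c * B.indicator 1 (fun e => ξ k e ω) ≤
      r.waitingTime (r.stateAfter (fun n e => ξ n e ω) k) fun e => ξ k e ω := fun k => by
    by_cases hk : (fun e => ξ k e ω) ∈ B
    · have h : ∀ e, c ≤ r.clock (r.stateAfter (fun n e => ξ n e ω) k) (fun e => ξ k e ω) e := fun e =>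
        (hmin (r.stateAfter (fun n e => ξ n e ω) k, e)).trans
          (div_le_div_of_nonneg_right (hk e (Set.mem_univ e)) (hr _ e).le)
      rw [Set.indicator_of_mem hk, Pi.one_apply, mul_one]
      exact le_min (h _) (le_min (h _) (h _))
    · simpa [hk] using Rates.waitingTime_nonneg hr _ (hω k)
  have hfreq : Tendsto (fun n : ℕ => (∑ k ∈ Finset.range n,
      B.indicator (1 : (Event → ℝ) → ℝ) (fun e => ξ k e ω)) / n) atTop (𝓝 q) := by
    have hadd := hlim.add_const q
    rw [zero_add] at hadd
    refine hadd.congr' ?_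
    filter_upwards [eventually_gt_atTop 0] with n hn
    have : (n : ℝ) ≠ 0 := by positivity
    simp only [Set.indicator_univ, Pi.one_apply, one_mul, Finset.sum_sub_distrib, Finset.sum_const,
      Finset.card_range, nsmul_eq_mul]
    field_simp
    ring
  have hcount : Tendsto (fun n : ℕ => ∑ k ∈ Finset.range n,
      B.indicator (1 : (Event → ℝ) → ℝ) (fun e => ξ k e ω)) atTop atTop := by
    refine (hfreq.pos_mul_atTop hqpos tendsto_natCast_atTop_atTop).congr' ?_
    filter_upwards [eventually_gt_atTop 0] with n hn
    have : (n : ℝ) ≠ 0 := by positivity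
    field_simp
  refine tendsto_atTop_mono (fun n => ?_)
    ((hcount.const_mul_atTop hcpos).comp (tendsto_add_atTop_nat 1))
  simp only [Function.comp_apply, Finset.mul_sum]
  exact Finset.sum_le_sum fun k _ => hwait k

end Typical

end MarkovMachine

theorem theorem1 (r : MarkovMachine.Rates)
    (hα : 0 < r.α) (hβ : 0 < r.β) (hγ : 0 < r.γ) (hlam : 0 < r.lam) (hmu : 0 < r.mu)
    {Ω : Type*} [MeasurableSpace Ω] (P : Measure Ω) [IsProbabilityMeasure P]
    (ξ : ℕ → MarkovMachine.Event → Ω → ℝ)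
    (hξ_meas : ∀ n e, Measurable (ξ n e))
    (hξ_law : ∀ n e, HasLaw (ξ n e) (expMeasure 1) P)
    (hξ_indep : iIndepFun (fun ne : ℕ × MarkovMachine.Event => ξ ne.1 ne.2) P) :
    (∃! p : MarkovMachine.State → ℝ, r.IsStationary p) ∧
    ∀ p : MarkovMachine.State → ℝ, r.IsStationary p →
      0 < ∑ i ∈ MarkovMachine.acceptStates, r.externalProb i * p i ∧
      0 < ∑ i ∈ MarkovMachine.rejectStates, r.externalProb i * p i ∧
      (∀ᵐ ω ∂P, limsup (fun t : ℝ => r.falseAcceptRatio (fun n e => ξ n e ω) t) atTop =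
        (∑ i ∈ MarkovMachine.falseAcceptStates, r.externalProb i * p i) /
          ∑ i ∈ MarkovMachine.acceptStates, r.externalProb i * p i) ∧
      (∀ᵐ ω ∂P, limsup (fun t : ℝ => r.falseRejectRatio (fun n e => ξ n e ω) t) atTop =
        (∑ i ∈ MarkovMachine.falseRejectStates, r.externalProb i * p i) /
          ∑ i ∈ MarkovMachine.rejectStates, r.externalProb i * p i) ∧
      r.FAR P ξ =
        (∑ i ∈ MarkovMachine.falseAcceptStates, r.externalProb i * p i) /
          ∑ i ∈ MarkovMachine.acceptStates, r.externalProb i * p i ∧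
      r.FRR P ξ =
        (∑ i ∈ MarkovMachine.falseRejectStates, r.externalProb i * p i) /
          ∑ i ∈ MarkovMachine.rejectStates, r.externalProb i * p i := by
  have hr := MarkovMachine.Rates.rate_pos hα hβ hγ hlam hmu
  have htyp := MarkovMachine.ae_isTypical hr hξ_meas hξ_law hξ_indep
  refine ⟨?_, fun p hp => ?_⟩
  · obtain ⟨ω, hω⟩ := htyp.exists
    obtain ⟨p, hp⟩ := hω.exists_isStationary
    exact ⟨p, hp, fun q hq => hp.eq hr hq⟩
  have hA := MarkovMachine.sum_externalProb_mul_pos (A := MarkovMachine.acceptStates) hr hp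
    ⟨⟨(0, 0), Or.inl ⟨by decide, by decide⟩⟩, by decide⟩
  have hR := MarkovMachine.sum_externalProb_mul_pos (A := MarkovMachine.rejectStates) hr hp
    ⟨⟨(2, 2), Or.inr rfl⟩, by decide⟩
  have hlim : ∀ A B : Finset MarkovMachine.State, 0 < ∑ i ∈ B, r.externalProb i * p i →
      ∀ᵐ ω ∂P, limsup (fun t : ℝ => (r.arrivalCount (fun n e => ξ n e ω) A t : ℝ) /
        (r.arrivalCount (fun n e => ξ n e ω) B t : ℝ)) atTop =
          (∑ i ∈ A, r.externalProb i * p i) / ∑ i ∈ B, r.externalProb i * p i := by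
    intro A B hB
    filter_upwards [htyp, MarkovMachine.ae_nonneg_clocks hξ_law,
      MarkovMachine.ae_tendsto_eventTime hr hξ_meas hξ_law hξ_indep] with ω hω hnonneg htop
    exact (hω.tendsto_arrivalCount_div hr
      (MarkovMachine.Rates.monotone_eventTime hr hnonneg) htop hp A hB).limsup_eq
  have hFA := hlim MarkovMachine.falseAcceptStates _ hA
  have hFR := hlim MarkovMachine.falseRejectStates _ hR
  refine ⟨hA, hR, hFA, hFR, ?_, ?_⟩
  · exact (integral_congr_ae hFA).trans (by simp)
  · exact (integral_congr_ae hFR).trans (by simp)
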